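/- A skew left brace is a triple $(A,+,\circ)$ in which $(A,+)$ and $(A,\circ)$ are (not necessarily abelian) groups on the same set such that $a\circ(b+c)=a\circ b-a+a\circ c$ for all $a,b,c\in A$. Let $\lambda\colon(A,\circ)\to\operatorname{Aut}(A,+)$ be the group homomorphism $\lambda_a(b)=-a+a\circ b$, and put $a*b=\lambda_a(b)-b$. The left series of $A$ is defined by $A^1=A$ and, for $n\ge 1$, $A^{n+1}=A*A^n$, the subgroup of $(A,+)$ generated by all $a*x$ with $a\in A$ and $x\in A^n$; the skew left brace $A$ is left nilpotent if $A^n=0$ for some $n\ge 1$. A group is locally nilpotent if each of its finitely generated subgroups is nilpotent. Theorem. Let $A$ be a left nilpotent skew left brace. Then: 1. the additive group of $A^2$ is locally nilpotent; 2. the multiplicative group of $A/\ker\lambda$, that is, the quotient group $(A,\circ)/\ker\lambda$, is locally nilpotent. -/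

import Mathlib

/-- A skew left brace `(A, +, ∘)`. Both groups may be non-abelian. The circle operation `∘` is
written `*` in Lean (so `a⁻¹` is the inverse for `∘`), and the axiom reads
`a ∘ (b + c) = a ∘ b - a + a ∘ c`. -/
class SkewLeftBrace (A : Type*) extends AddGroup A, Group A where
  mul_add_brace : ∀ a b c : A, a * (b + c) = a * b - a + a * c

namespace SkewLeftBrace

section

variable (A : Type*) [SkewLeftBrace A]

theorem lam_mul_aux (a b c : A) : -(a * b) + a * b * c = -a + a * (-b + b * c) := by
  have h := mul_add_brace a b (-b + b * c)
  rw [add_neg_cancel_left] at h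
  rw [mul_assoc, h, sub_eq_add_neg, add_assoc, neg_add_cancel_left]

theorem lam_one_aux (b : A) : -(1 : A) + 1 * b = b := by
  have h := mul_add_brace (1 : A) 0 0
  have h1 : (1 : A) = 0 := by simpa using h
  rw [one_mul, h1, neg_zero, zero_add]

variable {A}

/-- The automorphism `λ_a` of `(A, +)`, `λ_a (b) = -a + a ∘ b`. -/
def lamAut (a : A) : AddAut A where
  toFun b := -a + a * b
  invFun b := -a⁻¹ + a⁻¹ * b
  left_inv b := by
    beta_reduce
    rw [← lam_mul_aux, inv_mul_cancel, lam_one_aux]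
  right_inv b := by
    beta_reduce
    rw [← lam_mul_aux, mul_inv_cancel, lam_one_aux]
  map_add' b c := by
    rw [mul_add_brace, sub_eq_add_neg]
    simp only [add_assoc]

variable (A)

/-- The homomorphism `λ : (A, ∘) → Aut (A, +)`, `a ↦ λ_a`. Mathlib writes the automorphism group
`AddAut A` additively (its addition is composition), hence the `Multiplicative`. -/
def lam : A →* Multiplicative (AddAut A) :=
  MonoidHom.mk' (fun a => Multiplicative.ofAdd (lamAut a)) (fun a b => by
    apply Multiplicative.toAdd.injective
    apply AddEquiv.ext
    intro c
    exact lam_mul_aux A a b c)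

variable {A}

/-- The operation `a * b = λ_a (b) - b = -a + a ∘ b - b`. -/
def star (a b : A) : A := lamAut a b - b

/-- `X * Y`: the additive subgroup generated by all `x * y` with `x ∈ X`, `y ∈ Y`. -/
def starSpan (X Y : Set A) : AddSubgroup A :=
  AddSubgroup.closure {z | ∃ x ∈ X, ∃ y ∈ Y, z = star x y}

variable (A)

/-- The left series, indexed from zero: `leftSeries A n` is the term `A^{n+1}`, where `A^1 = A` and
`A^{n+1} = A * A^n`. -/
def leftSeries : ℕ → AddSubgroup A
  | 0 => ⊤
  | n + 1 => starSpan Set.univ (leftSeries n : Set A)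

/-- `A` is left nilpotent if some term of its left series is zero. -/
def IsLeftNilpotent : Prop := ∃ n : ℕ, leftSeries A n = ⊥

end

end SkewLeftBrace

/-- A group is locally nilpotent if all its finitely generated subgroups are nilpotent. -/
def IsLocallyNilpotentGroup (G : Type*) [Group G] : Prop :=
  ∀ H : Subgroup G, H.FG → Group.IsNilpotent H

/-- An additively written group is locally nilpotent if all its finitely generated subgroups are
nilpotent. -/
def IsLocallyNilpotentAddGroup (G : Type*) [AddGroup G] : Prop :=
  ∀ H : AddSubgroup G, H.FG → AddGroup.IsNilpotent H

/-!
Inside the permutations of `A`, let `M` be the image of `λ` and `N` the group of translations of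
`(A, +)`. The commutator of `λ_a` with the translation by `x` is the translation by `a * x`, so
the left series of `A` is the series `N, ⁅M, N⁆, ⁅M, ⁅M, N⁆⁆, …`, and left nilpotency says that it
reaches `⊥`. By Hall's theorem some term of the lower central series of `M` centralizes `N`; as a
group automorphism commuting with all translations is trivial, `M ≃ (A, ∘) / ker λ` is nilpotent.
The vanishing of the series also makes `M` subnormal in `M ⊔ N`; climbing up this subnormal chain,
each term is a join of conjugates of the previous one, so the Hirsch–Plotkin theorem shows that
`M ⊔ ⁅M, N⁆` is locally nilpotent, and this group contains `⁅M, N⁆ ≃ A^2`.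
-/

section CommutatorCalculus

open Subgroup

variable {G : Type*} [Group G]

theorem commutator_le_iff_le_comap_centralizer {H K E : Subgroup G} [E.Normal] :
    ⁅H, K⁆ ≤ E ↔
      H ≤ (centralizer (K.map (QuotientGroup.mk' E) : Set (G ⧸ E))).comap
        (QuotientGroup.mk' E) := by
  rw [← map_le_iff_le_comap, ← commutator_eq_bot_iff_le_centralizer, ← map_commutator,
    Subgroup.map_eq_bot_iff, QuotientGroup.ker_mk']

theorem sup_commutator_le_iff {H K L E : Subgroup G} [E.Normal] :
    ⁅H ⊔ K, L⁆ ≤ E ↔ ⁅H, L⁆ ≤ E ∧ ⁅K, L⁆ ≤ E := by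
  simp only [commutator_le_iff_le_comap_centralizer, sup_le_iff]

theorem sup_commutator (H K L : Subgroup G) [H.Normal] [K.Normal] [L.Normal] :
    ⁅H ⊔ K, L⁆ = ⁅H, L⁆ ⊔ ⁅K, L⁆ :=
  le_antisymm (sup_commutator_le_iff.2 ⟨le_sup_left, le_sup_right⟩)
    (sup_le (commutator_mono le_sup_left le_rfl) (commutator_mono le_sup_right le_rfl))

theorem commutator_sup (H K L : Subgroup G) [H.Normal] [K.Normal] [L.Normal] :
    ⁅H, K ⊔ L⁆ = ⁅H, K⁆ ⊔ ⁅H, L⁆ := by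
  simp only [commutator_comm H, sup_commutator]

/-- The iterated commutator `⁅M, ⁅M, …, ⁅M, N⁆⁆⁆` with `n` factors `M`. The left series of a skew
left brace is a series of this kind, and so is the lower central series. -/
def iteratedCommutator (M N : Subgroup G) (n : ℕ) : Subgroup G := (⁅M, ·⁆)^[n] N

theorem iteratedCommutator_succ (M N : Subgroup G) (n : ℕ) :
    iteratedCommutator M N (n + 1) = iteratedCommutator M ⁅M, N⁆ n := rfl

theorem iteratedCommutator_succ' (M N : Subgroup G) (n : ℕ) :
    iteratedCommutator M N (n + 1) = ⁅M, iteratedCommutator M N n⁆ :=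
  Function.iterate_succ_apply' _ n N

theorem iteratedCommutator_mono_right (M : Subgroup G) {N₁ N₂ : Subgroup G} (hN : N₁ ≤ N₂)
    (n : ℕ) : iteratedCommutator M N₁ n ≤ iteratedCommutator M N₂ n :=
  Monotone.iterate (fun _ _ h => commutator_mono le_rfl h) n hN

theorem iteratedCommutator_self (M : Subgroup G) (n : ℕ) :
    iteratedCommutator M M n = M.lowerCentralSeries n := by
  induction n with
  | zero => rfl
  | succ n ih =>
    rw [iteratedCommutator_succ', ih, Subgroup.lowerCentralSeries_succ, commutator_comm]

theorem iteratedCommutator_sup (M N₁ N₂ : Subgroup G) [M.Normal] [N₁.Normal] [N₂.Normal]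
    (n : ℕ) : iteratedCommutator M (N₁ ⊔ N₂) n =
      iteratedCommutator M N₁ n ⊔ iteratedCommutator M N₂ n := by
  induction n generalizing N₁ N₂ with
  | zero => rfl
  | succ n ih => simp only [iteratedCommutator_succ, commutator_sup, ih]

theorem iteratedCommutator_sup_left_eq_bot {P Q N : Subgroup G} [P.Normal] [Q.Normal] [N.Normal]
    {i j : ℕ} (hP : iteratedCommutator P N i = ⊥) (hQ : iteratedCommutator Q N j = ⊥) :
    iteratedCommutator (P ⊔ Q) N (i + j) = ⊥ := by
  have iteratedCommutator_bot (n : ℕ) : iteratedCommutator (P ⊔ Q) ⊥ n = ⊥ :=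
    Function.iterate_fixed (commutator_bot_right _) n
  induction i generalizing N j with
  | zero => rw [show N = ⊥ from hP, iteratedCommutator_bot]
  | succ i ihi =>
    induction j generalizing N with
    | zero => rw [show N = ⊥ from hQ, iteratedCommutator_bot]
    | succ j ihj =>
      have hPN : iteratedCommutator (P ⊔ Q) ⁅P, N⁆ (i + (j + 1)) = ⊥ :=
        ihi hP (le_bot_iff.1 (hQ ▸ iteratedCommutator_mono_right Q (commutator_le_right _ _) _))
      have hQN : iteratedCommutator (P ⊔ Q) ⁅Q, N⁆ (i + 1 + j) = ⊥ :=
        ihj (le_bot_iff.1 (hP ▸ iteratedCommutator_mono_right P (commutator_le_right _ _) _)) hQ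
      rw [← add_assoc, iteratedCommutator_succ, sup_commutator, iteratedCommutator_sup, hQN,
        sup_bot_eq, ← hPN]
      congr 1
      omega

theorem isNilpotent_sup_of_normal {P Q : Subgroup G} [P.Normal] [Q.Normal]
    (hP : Group.IsNilpotent P) (hQ : Group.IsNilpotent Q) :
    Group.IsNilpotent (P ⊔ Q : Subgroup G) := by
  have exists_eq_bot {R S : Subgroup G} [R.Normal] (hR : Group.IsNilpotent R) :
      ∃ n, iteratedCommutator R S n = ⊥ := by
    obtain ⟨n, hn⟩ := R.isNilpotent_iff_lowerCentralSeries.1 hR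
    rw [← iteratedCommutator_self] at hn
    exact ⟨n + 1, le_bot_iff.1 (hn ▸ iteratedCommutator_mono_right R (commutator_le_left _ _) n)⟩
  obtain ⟨i, hi⟩ := exists_eq_bot hP
  obtain ⟨j, hj⟩ := exists_eq_bot hQ
  refine isNilpotent_of_lowerCentralSeries_eq_bot (n := i + j) ?_
  rw [← iteratedCommutator_self, iteratedCommutator_sup_left_eq_bot hi hj]

/-- **Fitting's theorem**, without assuming `P` and `Q` normal in the whole group. -/
theorem isNilpotent_sup_of_le_normalizer {P Q : Subgroup G} (hPQ : P ≤ normalizer (Q : Set G))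
    (hQP : Q ≤ normalizer (P : Set G)) (hP : Group.IsNilpotent P) (hQ : Group.IsNilpotent Q) :
    Group.IsNilpotent (P ⊔ Q : Subgroup G) := by
  have : (P.subgroupOf (P ⊔ Q)).Normal :=
    normal_subgroupOf_of_le_normalizer (sup_le le_normalizer hQP)
  have : (Q.subgroupOf (P ⊔ Q)).Normal :=
    normal_subgroupOf_of_le_normalizer (sup_le hPQ le_normalizer)
  have h : Group.IsNilpotent (P.subgroupOf (P ⊔ Q) ⊔ Q.subgroupOf (P ⊔ Q) : Subgroup _) :=
    isNilpotent_sup_of_normal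
      ((Group.isNilpotent_congr (subgroupOfEquivOfLe le_sup_left)).2 hP)
      ((Group.isNilpotent_congr (subgroupOfEquivOfLe le_sup_right)).2 hQ)
  rw [← subgroupOf_sup le_sup_left le_sup_right, subgroupOf_self] at h
  exact Group.isNilpotent_top.1 h

end CommutatorCalculus

section HallTheorem

open Subgroup
open scoped commutatorElement

variable {G : Type*} [Group G]

theorem commutator_commutator_le_of_rotate_of_normal {H K L E : Subgroup G} [E.Normal]
    (hKL : ⁅⁅K, L⁆, H⁆ ≤ E) (hLH : ⁅⁅L, H⁆, K⁆ ≤ E) : ⁅⁅H, K⁆, L⁆ ≤ E := by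
  rw [← QuotientGroup.ker_mk' E, ← Subgroup.map_eq_bot_iff, map_commutator, map_commutator]
    at hKL hLH ⊢
  exact commutator_commutator_eq_bot_of_rotate hKL hLH

theorem commutator_commutator_le_of_rotate {H K L E : Subgroup G}
    (hH : H ≤ normalizer (E : Set G)) (hK : K ≤ normalizer (E : Set G))
    (hL : L ≤ normalizer (E : Set G)) (hKL : ⁅⁅K, L⁆, H⁆ ≤ E) (hLH : ⁅⁅L, H⁆, K⁆ ≤ E) :
    ⁅⁅H, K⁆, L⁆ ≤ E := by
  rw [← map_subgroupOf_eq_of_le hH, ← map_subgroupOf_eq_of_le hK, ← map_subgroupOf_eq_of_le hL,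
    ← map_commutator, ← map_commutator, map_le_iff_le_comap] at hKL hLH ⊢
  exact commutator_commutator_le_of_rotate_of_normal (E := E.subgroupOf _) hKL hLH

theorem le_normalizer_centralizer {H K : Subgroup G} (hHK : H ≤ normalizer (K : Set G)) :
    H ≤ normalizer (centralizer (K : Set G) : Set G) := by
  rw [le_normalizer_iff_commutator_le_right, commutator_comm,
    ← commutator_eq_bot_iff_le_centralizer]
  have hcentralizer : ⁅K, centralizer (K : Set G)⁆ = ⊥ := by
    rw [commutator_comm, commutator_eq_bot_iff_le_centralizer]
  refine commutator_commutator_eq_bot_of_rotate (le_bot_iff.1 ?_) ?_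
  · exact hcentralizer ▸ commutator_mono (le_normalizer_iff_commutator_le_right.1 hHK) le_rfl
  · rw [hcentralizer, commutator_bot_left]

theorem le_normalizer_commutator_of_le_centralizer {M N E : Subgroup G}
    (hM : M ≤ normalizer (E : Set G)) (hN : N ≤ normalizer (E : Set G))
    (hE : E ≤ centralizer (⁅N, M⁆ : Subgroup G)) : N ≤ normalizer (⁅M, E⁆ : Subgroup G) := by
  rw [le_normalizer_iff]
  intro g hg
  suffices ⁅M, E⁆ ≤ ⁅M, E⁆.comap (MulAut.conj g).toMonoidHom from fun x hx => this hx
  refine commutator_le.2 fun m hm e he => ?_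
  have he' : g * e * g⁻¹ ∈ E := le_normalizer_iff.1 hN g hg e he
  have hcomm (x : G) (hx : x ∈ E) : ⁅g, m⁆ * x = x * ⁅g, m⁆ :=
    mem_centralizer_iff.1 (hE hx) _ (commutator_mem_commutator hg hm)
  have hconj : g * ⁅m, e⁆ * g⁻¹ = ⁅m, g * e * g⁻¹⁆ := by
    calc g * ⁅m, e⁆ * g⁻¹
        = ⁅⁅g, m⁆ * m, g * e * g⁻¹⁆ := by
          rw [conjugate_commutatorElement, commutatorElement_def g m, inv_mul_cancel_right]
      _ = ⁅g, m⁆ * ⁅m, g * e * g⁻¹⁆ * ⁅g, m⁆⁻¹ * ⁅⁅g, m⁆, g * e * g⁻¹⁆ :=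
          commutatorElement_mul_left_eq_conj_mul _ _ _
      _ = ⁅m, g * e * g⁻¹⁆ := by
          rw [commutatorElement_eq_one_iff_mul_comm.2 (hcomm _ he'), mul_one,
            mul_inv_eq_iff_eq_mul, hcomm _ (le_normalizer_iff_commutator_le_right.1 hM
              (commutator_mem_commutator hm he'))]
  change g * ⁅m, e⁆ * g⁻¹ ∈ ⁅M, E⁆
  exact hconj ▸ commutator_mem_commutator hm he'

theorem commutator_commutator_le_of_le_centralizer {K M N E : Subgroup G}
    (hM : M ≤ normalizer (E : Set G)) (hN : N ≤ normalizer (E : Set G))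
    (hE : E ≤ centralizer (⁅M, N⁆ : Subgroup G)) (hKM : K ≤ M)
    (hK : K ≤ centralizer (⁅M, N⁆ : Subgroup G)) (hKN : ⁅K, N⁆ ≤ E) :
    ⁅⁅K, M⁆, N⁆ ≤ ⁅M, E⁆ := by
  refine commutator_commutator_le_of_rotate (hKM.trans (normalizer_commutator_ge_left _ _))
    (normalizer_commutator_ge_left _ _)
    (le_normalizer_commutator_of_le_centralizer hM hN (commutator_comm M N ▸ hE)) ?_ ?_
  · rw [commutator_comm ⁅M, N⁆, commutator_eq_bot_iff_le_centralizer.2 hK]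
    exact bot_le
  · rw [commutator_comm N K, commutator_comm M]
    exact commutator_mono hKN le_rfl

theorem iteratedCommutator_le_of_le_normalizer {M N : Subgroup G}
    (hMN : M ≤ normalizer (N : Set G)) (n : ℕ) : iteratedCommutator M N n ≤ N := by
  induction n generalizing N with
  | zero => exact le_rfl
  | succ n ih =>
    exact (ih (normalizer_commutator_ge_left M N)).trans
      (le_normalizer_iff_commutator_le_right.1 hMN)

theorem le_normalizer_iteratedCommutator {M N : Subgroup G} (hMN : M ≤ normalizer (N : Set G))
    (n : ℕ) : M ≤ normalizer (iteratedCommutator M N n : Set G) := by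
  cases n with
  | zero => exact hMN
  | succ n =>
    rw [iteratedCommutator_succ']
    exact normalizer_commutator_ge_left _ _

/-- Once a term of the lower central series of `M` centralizes `⁅M, N⁆`, every further commutation
with `M` pushes its commutator with `N` one step down, by the three subgroups lemma. -/
theorem lowerCentralSeries_commutator_le_iteratedCommutator {M N : Subgroup G} {c : ℕ}
    (hc : M.lowerCentralSeries c ≤ centralizer (⁅M, N⁆ : Subgroup G)) (l : ℕ) :
    ⁅M.lowerCentralSeries (c + l), N⁆ ≤
      iteratedCommutator M (⁅M, N⁆ ⊓ centralizer (⁅M, N⁆ : Subgroup G)) l := by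
  set L := ⁅M, N⁆
  set E := iteratedCommutator M (L ⊓ centralizer (L : Set G))
  have normalizes_zero {R : Subgroup G} (hR : R ≤ normalizer (L : Set G)) :
      R ≤ normalizer (E 0 : Set G) :=
    (le_inf hR (le_normalizer_centralizer hR)).trans (inf_normalizer_le_normalizer_inf)
  have hM : M ≤ normalizer (E 0 : Set G) := normalizes_zero (normalizer_commutator_ge_left M N)
  have hE (l : ℕ) : E l ≤ centralizer (L : Set G) :=
    (iteratedCommutator_le_of_le_normalizer hM l).trans inf_le_right
  have hN (l : ℕ) : N ≤ normalizer (E l : Set G) := by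
    induction l with
    | zero => exact normalizes_zero (normalizer_commutator_ge_right M N)
    | succ l ih =>
      simp only [E, iteratedCommutator_succ']
      exact le_normalizer_commutator_of_le_centralizer (le_normalizer_iteratedCommutator hM l) ih
        (commutator_comm M N ▸ hE l)
  induction l with
  | zero =>
    exact le_inf (commutator_mono (lowerCentralSeries_le_self M c) le_rfl)
      ((commutator_mono hc le_rfl).trans (le_normalizer_iff_commutator_le_left.1
        (le_normalizer_centralizer (normalizer_commutator_ge_right M N))))
  | succ l ih =>
    simp only [E, iteratedCommutator_succ']
    exact commutator_commutator_le_of_le_centralizer (le_normalizer_iteratedCommutator hM l)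
      (hN l) (hE l) (lowerCentralSeries_le_self M _)
      ((Subgroup.lowerCentralSeries_antitone M (Nat.le_add_right c l)).trans hc) ih

/-- **Hall's theorem** on stability groups, with no normality assumption on `M` and `N`. -/
theorem exists_lowerCentralSeries_le_centralizer {M N : Subgroup G} {n : ℕ}
    (hn : iteratedCommutator M N n = ⊥) :
    ∃ c, M.lowerCentralSeries c ≤ centralizer (N : Set G) := by
  simp only [← commutator_eq_bot_iff_le_centralizer]
  induction n generalizing N with
  | zero => exact ⟨0, by rw [show N = ⊥ from hn, commutator_bot_right]⟩
  | succ n ih =>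
    obtain ⟨c, hc⟩ := ih hn
    exact ⟨c + n, le_bot_iff.1 <|
      (lowerCentralSeries_commutator_le_iteratedCommutator
        (commutator_eq_bot_iff_le_centralizer.1 hc) n).trans
      (hn ▸ iteratedCommutator_mono_right M inf_le_left n)⟩

end HallTheorem

section LocallyNilpotent

open Subgroup
open scoped commutatorElement

variable {G : Type*} [Group G]

theorem isLocallyNilpotentGroup_iff_of_injective {G' : Type*} [Group G'] {f : G →* G'}
    (hf : Function.Injective f) :
    IsLocallyNilpotentGroup G ↔ ∀ F ≤ f.range, F.FG → Group.IsNilpotent F := by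
  refine ⟨fun hG F hF hFG => ?_, fun h K hK => ?_⟩
  · obtain ⟨K, rfl⟩ : ∃ K : Subgroup G, K.map f = F := ⟨F.comap f, map_comap_eq_self hF⟩
    have e := K.equivMapOfInjective f hf
    have : Group.FG (K.map f) := (Group.fg_iff_subgroup_fg _).2 hFG
    have : Group.FG K := Group.fg_of_surjective (f := e.symm.toMonoidHom) e.symm.surjective
    exact (Group.isNilpotent_congr e).1 (hG K ((Group.fg_iff_subgroup_fg K).1 this))
  · have hKfFG : (K.map f).FG :=
      (fg_iff_submonoid_fg _).2 (((fg_iff_submonoid_fg K).1 hK).map f)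
    exact (Group.isNilpotent_congr (K.equivMapOfInjective f hf)).2 (h _ (map_le_range f K) hKfFG)

theorem isLocallyNilpotentGroup_subgroup_iff {H : Subgroup G} :
    IsLocallyNilpotentGroup H ↔ ∀ F ≤ H, F.FG → Group.IsNilpotent F := by
  simpa only [range_subtype] using isLocallyNilpotentGroup_iff_of_injective H.subtype_injective

theorem IsLocallyNilpotentGroup.of_injective {G' : Type*} [Group G'] {f : G →* G'}
    (hf : Function.Injective f) (hG' : IsLocallyNilpotentGroup G') : IsLocallyNilpotentGroup G :=
  (isLocallyNilpotentGroup_iff_of_injective hf).2 fun F _ => hG' F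

theorem IsLocallyNilpotentGroup.mono {H K : Subgroup G} (hHK : H ≤ K)
    (hK : IsLocallyNilpotentGroup K) : IsLocallyNilpotentGroup H :=
  hK.of_injective (inclusion_injective hHK)

theorem isLocallyNilpotentGroup_of_isNilpotent [Group.IsNilpotent G] : IsLocallyNilpotentGroup G :=
  fun H _ => isNilpotent H

theorem exists_le_of_fg_of_directed {ι : Type*} [Nonempty ι] {K : ι → Subgroup G}
    (hK : Directed (· ≤ ·) K) {F : Subgroup G} (hF : F.FG) (hFK : F ≤ ⨆ i, K i) :
    ∃ i, F ≤ K i := by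
  obtain ⟨S, rfl, hS⟩ := (fg_iff F).1 hF
  choose! i hi using fun s (hs : s ∈ S) => (mem_iSup_of_directed hK).1 (hFK (subset_closure hs))
  obtain ⟨j, hj⟩ := hK.finite_set_le (hS.image i)
  exact ⟨j, (closure_le _).2 fun s hs => hj _ (Set.mem_image_of_mem i hs) (hi s hs)⟩

theorem sup_le_normalizer_sup_commutator (M N : Subgroup G) :
    M ⊔ N ≤ normalizer (M ⊔ ⁅M, N⁆ : Subgroup G) := by
  refine sup_le (le_sup_left.trans le_normalizer) (le_normalizer_iff.2 fun g hg => ?_)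
  suffices M ⊔ ⁅M, N⁆ ≤ (M ⊔ ⁅M, N⁆).comap (MulAut.conj g).toMonoidHom from fun x hx => this hx
  refine sup_le (fun m hm => ?_) fun c hc => ?_
  · have : ⁅g, m⁆ ∈ ⁅M, N⁆ := commutator_comm N M ▸ commutator_mem_commutator hg hm
    simpa [commutatorElement_def] using mul_mem (mem_sup_right this) (mem_sup_left hm)
  · exact mem_sup_right (le_normalizer_iff.1 (normalizer_commutator_ge_right M N) g hg c hc)

/-- The generators are monoid generators: commutators with `s` staying in `U` say nothing about
commutators with `s⁻¹`. -/
theorem le_normalizer_closure_of_commutator_mem {X : Subgroup G} {S U : Set G}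
    (hS : Submonoid.closure S = X.toSubmonoid) (hSU : ∀ s ∈ S, ∀ u ∈ U, ⁅s, u⁆ ∈ U) :
    X ≤ normalizer (closure U : Set G) := by
  refine le_normalizer_iff.2 fun x hx => ?_
  replace hx : x ∈ Submonoid.closure S := hS ▸ hx
  induction hx using Submonoid.closure_induction with
  | mem s hs =>
    suffices closure U ≤ (closure U).comap (MulAut.conj s).toMonoidHom from fun x hx => this hx
    refine (closure_le _).2 fun u hu => ?_
    simpa [commutatorElement_def] using
      mul_mem (subset_closure (hSU s hs u hu)) (subset_closure hu)
  | one => simp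
  | mul x y _ _ ihx ihy =>
    intro k hk
    simpa [mul_assoc] using ihx _ (ihy k hk)

/-- The set of iterated commutators `⁅s₁, ⁅s₂, …, ⁅sₙ, t⁆⁆⁆` with `sᵢ ∈ S` and `t ∈ T`, used to
write down finite generating sets. -/
def iteratedCommutatorSet (S T : Set G) (n : ℕ) : Set G := (Set.image2 (⁅·, ·⁆) S)^[n] T

theorem iteratedCommutatorSet_succ' (S T : Set G) (n : ℕ) :
    iteratedCommutatorSet S T (n + 1) = Set.image2 (⁅·, ·⁆) S (iteratedCommutatorSet S T n) :=
  Function.iterate_succ_apply' _ n T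

theorem iteratedCommutatorSet_succ_subset_lowerCentralSeries {M : Subgroup G} {S T : Set G}
    (hS : S ⊆ M) (hST : Set.image2 (⁅·, ·⁆) S T ⊆ M) (n : ℕ) :
    iteratedCommutatorSet S T (n + 1) ⊆ M.lowerCentralSeries n := by
  induction n with
  | zero => exact hST
  | succ n ih =>
    rw [iteratedCommutatorSet_succ', Set.image2_subset_iff, Subgroup.lowerCentralSeries_succ,
      commutator_comm]
    exact fun s hs t ht => commutator_mem_commutator (hS hs) (ih ht)

theorem iteratedCommutatorSet_subset {R : Subgroup G} {S T : Set G}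
    (hS : S ⊆ normalizer (R : Set G)) (hT : T ⊆ R) (n : ℕ) : iteratedCommutatorSet S T n ⊆ R := by
  induction n with
  | zero => exact hT
  | succ n ih =>
    rw [iteratedCommutatorSet_succ', Set.image2_subset_iff]
    exact fun s hs t ht => le_normalizer_iff_commutator_le_right.1 le_rfl
      (commutator_mem_commutator (hS hs) (ih ht))

theorem finite_iteratedCommutatorSet {S T : Set G} (hS : S.Finite) (hT : T.Finite) (n : ℕ) :
    (iteratedCommutatorSet S T n).Finite := by
  induction n with
  | zero => exact hT
  | succ n ih => exact iteratedCommutatorSet_succ' S T n ▸ hS.image2 _ ih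

theorem finite_iUnion_iteratedCommutatorSet {S T : Set G} (hS : S.Finite) (hT : T.Finite)
    (hST : Group.IsNilpotent (closure (S ∪ Set.image2 (⁅·, ·⁆) S T))) :
    (⋃ n, iteratedCommutatorSet S T n).Finite := by
  obtain ⟨c, hc⟩ := (isNilpotent_iff_lowerCentralSeries _).1 hST
  refine (((Set.finite_Iic c).biUnion fun n _ => finite_iteratedCommutatorSet hS hT n).union
    (Set.finite_singleton 1)).subset (Set.iUnion_subset fun n x hx => ?_)
  rcases le_or_gt n c with hn | hn
  · exact Or.inl (Set.mem_biUnion hn hx)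
  · obtain ⟨k, rfl⟩ := Nat.exists_eq_succ_of_ne_zero (Nat.ne_zero_of_lt hn)
    refine Or.inr (mem_bot.1 (hc ▸ ?_))
    refine Subgroup.lowerCentralSeries_antitone _ (Nat.le_of_lt_succ hn) ?_
    exact iteratedCommutatorSet_succ_subset_lowerCentralSeries
      (Set.subset_union_left.trans subset_closure)
      (Set.subset_union_right.trans subset_closure) k hx

theorem closure_iUnion_iteratedCommutatorSet {X Y : Subgroup G} {S T : Set G}
    (hS : Submonoid.closure S = X.toSubmonoid) (hT : closure T = Y) :
    closure (⋃ n, iteratedCommutatorSet S T n) = Y ⊔ ⁅X, Y⁆ := by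
  set U := ⋃ n, iteratedCommutatorSet S T n
  have hSX : S ⊆ X := Submonoid.closure_le.1 hS.le
  have hTY : T ⊆ Y := (closure_le Y).1 hT.le
  have hY : Y ≤ closure U :=
    hT ▸ closure_mono (Set.subset_iUnion (iteratedCommutatorSet S T) 0)
  have hX : X ≤ normalizer (closure U : Set G) := by
    refine le_normalizer_closure_of_commutator_mem hS fun s hs u hu => ?_
    obtain ⟨n, hn⟩ := Set.mem_iUnion.1 hu
    exact Set.mem_iUnion.2 ⟨n + 1, iteratedCommutatorSet_succ' S T n ▸ ⟨s, hs, u, hn, rfl⟩⟩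
  have hX' : X ≤ normalizer (Y ⊔ ⁅X, Y⁆ : Subgroup G) :=
    le_sup_right.trans (commutator_comm Y X ▸ sup_le_normalizer_sup_commutator Y X)
  refine le_antisymm ((closure_le _).2 (Set.iUnion_subset
    (iteratedCommutatorSet_subset (hSX.trans hX') (hTY.trans ?_)))) (sup_le hY ?_)
  · exact SetLike.coe_subset_coe.2 le_sup_left
  · exact (commutator_mono le_rfl hY).trans (le_normalizer_iff_commutator_le_right.1 hX)

/-- The iterated commutators of generators of `X` with generators of `Y` generate `Y ⊔ ⁅X, Y⁆`, and
only finitely many of them are nontrivial because they lie in a nilpotent group. -/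
theorem fg_sup_commutator {X Y : Subgroup G} (hX : X.FG) (hY : Y.FG)
    (hXY : IsLocallyNilpotentGroup (X ⊔ ⁅X, Y⁆ : Subgroup G)) : (Y ⊔ ⁅X, Y⁆).FG := by
  obtain ⟨S, hSX, hS⟩ := (Submonoid.fg_iff _).1 ((fg_iff_submonoid_fg X).1 hX)
  obtain ⟨T, hTY, hT⟩ := (fg_iff Y).1 hY
  refine (fg_iff _).2 ⟨_, closure_iUnion_iteratedCommutatorSet hSX hTY,
    finite_iUnion_iteratedCommutatorSet hS hT ?_⟩
  refine isLocallyNilpotentGroup_subgroup_iff.1 hXY _ ((closure_le _).2 (Set.union_subset ?_ ?_))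
    ((fg_iff _).2 ⟨_, rfl, hS.union (hS.image2 _ hT)⟩)
  · exact fun s hs => mem_sup_left (Submonoid.closure_le.1 hSX.le hs)
  · exact Set.image2_subset_iff.2 fun s hs t ht => mem_sup_right <|
      commutator_mem_commutator (Submonoid.closure_le.1 hSX.le hs) ((closure_le Y).1 hTY.le ht)

theorem exists_fg_le_sup_of_le_sup {H K F : Subgroup G} (hHK : H ≤ normalizer (K : Set G))
    (hF : F.FG) (hFHK : F ≤ H ⊔ K) : ∃ X ≤ H, X.FG ∧ ∃ Y ≤ K, Y.FG ∧ F ≤ X ⊔ Y := by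
  obtain ⟨S, rfl, hS⟩ := (fg_iff F).1 hF
  have hmul : ∀ s ∈ S, ∃ h ∈ H, ∃ k ∈ K, h * k = s := fun s hs =>
    Set.mem_mul.1 (coe_mul_of_left_le_normalizer_right H K hHK ▸ hFHK (subset_closure hs))
  choose! h hh k hk hhk using hmul
  refine ⟨closure (h '' S), (closure_le _).2 (Set.image_subset_iff.2 hh),
    (fg_iff _).2 ⟨_, rfl, hS.image h⟩, closure (k '' S), (closure_le _).2
    (Set.image_subset_iff.2 hk), (fg_iff _).2 ⟨_, rfl, hS.image k⟩, (closure_le _).2 fun s hs => ?_⟩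
  exact hhk s hs ▸ mul_mem_sup (subset_closure (Set.mem_image_of_mem h hs))
    (subset_closure (Set.mem_image_of_mem k hs))

/-- The **Hirsch–Plotkin theorem**. For finitely generated `X ≤ H` and `Y ≤ K`, the join `X ⊔ Y` is
the product of its normal subgroups `X ⊔ ⁅X, Y⁆ ≤ H` and `Y ⊔ ⁅X, Y⁆ ≤ K`, which turn out to be
finitely generated again, so that Fitting's theorem applies. -/
theorem isLocallyNilpotentGroup_sup {H K : Subgroup G} (hHK : H ≤ normalizer (K : Set G))
    (hKH : K ≤ normalizer (H : Set G)) (hH : IsLocallyNilpotentGroup H)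
    (hK : IsLocallyNilpotentGroup K) : IsLocallyNilpotentGroup (H ⊔ K : Subgroup G) := by
  refine isLocallyNilpotentGroup_subgroup_iff.2 fun F hFHK hF => ?_
  obtain ⟨X, hXH, hX, Y, hYK, hY, hFXY⟩ := exists_fg_le_sup_of_le_sup hHK hF hFHK
  set P := X ⊔ ⁅X, Y⁆
  set Q := Y ⊔ ⁅X, Y⁆
  have hPH : P ≤ H :=
    sup_le hXH ((commutator_mono hXH hYK).trans (le_normalizer_iff_commutator_le_left.1 hKH))
  have hQK : Q ≤ K :=
    sup_le hYK ((commutator_mono hXH hYK).trans (le_normalizer_iff_commutator_le_right.1 hHK))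
  have hQfg : Q.FG := fg_sup_commutator hX hY (hH.mono hPH)
  have hPfg : P.FG := by
    have := fg_sup_commutator hY hX (commutator_comm X Y ▸ hK.mono hQK)
    rwa [commutator_comm Y X] at this
  have hP : X ⊔ Y ≤ normalizer (P : Set G) := sup_le_normalizer_sup_commutator X Y
  have hQ : X ⊔ Y ≤ normalizer (Q : Set G) := by
    have := sup_le_normalizer_sup_commutator Y X
    rwa [sup_comm, commutator_comm] at this
  have : Group.IsNilpotent (P ⊔ Q : Subgroup G) :=
    isNilpotent_sup_of_le_normalizer
      ((sup_le le_sup_left (commutator_le_sup X Y)).trans hQ)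
      ((sup_le le_sup_right (commutator_le_sup X Y)).trans hP)
      (isLocallyNilpotentGroup_subgroup_iff.1 hH P hPH hPfg)
      (isLocallyNilpotentGroup_subgroup_iff.1 hK Q hQK hQfg)
  have hPQ : IsLocallyNilpotentGroup (P ⊔ Q : Subgroup G) := isLocallyNilpotentGroup_of_isNilpotent
  exact isLocallyNilpotentGroup_subgroup_iff.1 hPQ F
    (hFXY.trans (sup_le_sup le_sup_left le_sup_left)) hF

theorem le_normalizer_iSup {ι : Sort*} {R : Subgroup G} {H : ι → Subgroup G}
    (h : ∀ i, R ≤ normalizer (H i : Set G)) : R ≤ normalizer (⨆ i, H i : Subgroup G) :=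
  (le_iInf h).trans (iInf_normalizer_le_normalizer_iSup H)

theorem isLocallyNilpotentGroup_iSup {ι : Type*} {H : ι → Subgroup G}
    (hnorm : ∀ i j, H i ≤ normalizer (H j : Set G)) (hH : ∀ i, IsLocallyNilpotentGroup (H i)) :
    IsLocallyNilpotentGroup (⨆ i, H i : Subgroup G) := by
  classical
  have hfin (s : Finset ι) : IsLocallyNilpotentGroup (⨆ i ∈ s, H i : Subgroup G) := by
    induction s using Finset.induction_on with
    | empty =>
      rw [show ⨆ i ∈ (∅ : Finset ι), H i = ⊥ by simp]
      exact isLocallyNilpotentGroup_of_isNilpotent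
    | insert a s _ ih =>
      rw [Finset.iSup_insert]
      exact isLocallyNilpotentGroup_sup
        (le_normalizer_iSup fun i => le_normalizer_iSup fun _ => hnorm a i)
        (iSup₂_le fun i _ => hnorm i a) (hH a) ih
  have hdirected : Directed (· ≤ ·) fun s : Finset ι => ⨆ i ∈ s, H i :=
    Monotone.directed_le fun s t hst => biSup_mono fun i hi => Finset.mem_of_subset hst hi
  refine isLocallyNilpotentGroup_subgroup_iff.2 fun F hFH hF => ?_
  rw [iSup_eq_iSup_finset] at hFH
  obtain ⟨s, hs⟩ := exists_le_of_fg_of_directed hdirected hF hFH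
  exact isLocallyNilpotentGroup_subgroup_iff.1 (hfin s) F hs hF

/-- Subnormality in disguise: `M ⊔ ⁅M, N⁆` is generated by the conjugates of `M ⊔ ⁅M, ⁅M, N⁆⁆` under
`N`, because `⁅m, g⁆ = m * (g * m⁻¹ * g⁻¹)`, and each of these is normal in it. -/
theorem isLocallyNilpotentGroup_sup_commutator {M N : Subgroup G} {n : ℕ}
    (hn : iteratedCommutator M N n = ⊥) (hM : IsLocallyNilpotentGroup M) :
    IsLocallyNilpotentGroup (M ⊔ ⁅M, N⁆ : Subgroup G) := by
  induction n generalizing N with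
  | zero => rwa [show N = ⊥ from hn, commutator_bot_right, sup_bot_eq]
  | succ n ih =>
    set K := M ⊔ ⁅M, N⁆
    set H := M ⊔ ⁅M, ⁅M, N⁆⁆
    have hHK : H ≤ K := sup_le_sup_left
      (le_normalizer_iff_commutator_le_right.1 (normalizer_commutator_ge_left M N)) M
    have hKH : K ≤ normalizer (H : Set G) := sup_le_normalizer_sup_commutator M ⁅M, N⁆
    set conjugate : N → Subgroup G := fun g => H.map (MulAut.conj (g : G)).toMonoidHom
    have hKconj (g : N) : K.map (MulAut.conj (g : G)).toMonoidHom = K :=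
      mem_normalizer_iff_map_conj_eq.1
        (sup_le_normalizer_sup_commutator M N (mem_sup_right g.2))
    have hconj_le (g : N) : conjugate g ≤ K := (map_mono hHK).trans_eq (hKconj g)
    have hK_le (g : N) : K ≤ normalizer (conjugate g : Set G) :=
      (hKconj g).symm.trans_le ((map_mono hKH).trans (le_normalizer_map _))
    have hmem (g : N) {m : G} (hm : m ∈ M) : (g : G) * m * (g : G)⁻¹ ∈ ⨆ g, conjugate g :=
      mem_iSup_of_mem g (mem_map_of_mem _ (mem_sup_left hm))
    have hM_le : M ≤ ⨆ g, conjugate g := fun m hm => by simpa using hmem 1 hm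
    have hK : K ≤ ⨆ g, conjugate g := by
      refine sup_le hM_le (commutator_le.2 fun m hm g hg => ?_)
      simpa only [commutatorElement_def, mul_assoc] using
        mul_mem (hM_le hm) (hmem ⟨g, hg⟩ (inv_mem hm))
    refine IsLocallyNilpotentGroup.mono hK (isLocallyNilpotentGroup_iSup
      (fun g h => (hconj_le g).trans (hK_le h)) fun g => ?_)
    exact (ih hn).of_injective
      (f := (H.equivMapOfInjective _ (MulAut.conj (g : G)).injective).symm.toMonoidHom)
      (MulEquiv.injective _)

end LocallyNilpotent

section AdditiveGroup

variable (A : Type*) [AddGroup A]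

/-- The left regular representation of an additive group. -/
def translationHom : Multiplicative A →* Equiv.Perm A :=
  AddMonoidHom.toMultiplicativeLeft (AddAction.toPermHom A A)

/-- The tautological action of `Aut (A, +)` on `A`; together with `translationHom` it realizes
the holomorph of `A` inside the permutations of `A`. -/
def addAutHom : Multiplicative (AddAut A) →* Equiv.Perm A :=
  AddMonoidHom.toMultiplicativeLeft (AddAut.toPerm A)

variable {A}

@[simp]
theorem translationHom_apply (x : Multiplicative A) (b : A) :
    translationHom A x b = x.toAdd + b := rfl

@[simp]
theorem addAutHom_apply (e : Multiplicative (AddAut A)) (b : A) :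
    addAutHom A e b = e.toAdd b := rfl

theorem translationHom_injective : Function.Injective (translationHom A) := fun x y h => by
  simpa using DFunLike.congr_fun h 0

theorem addAutHom_injective : Function.Injective (addAutHom A) := fun x y h =>
  show x.toAdd = y.toAdd from AddEquiv.ext fun b => DFunLike.congr_fun h b

open scoped commutatorElement in
theorem commutatorElement_addAutHom_translationHom (e : Multiplicative (AddAut A)) (x : A) :
    ⁅addAutHom A e, translationHom A (.ofAdd x)⁆ = translationHom A (.ofAdd (e.toAdd x - x)) := by
  rw [commutatorElement_def, mul_inv_eq_iff_eq_mul, mul_inv_eq_iff_eq_mul]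
  ext b
  simp

theorem disjoint_range_addAutHom_centralizer :
    Disjoint (addAutHom A).range
      (Subgroup.centralizer ((translationHom A).range : Set (Equiv.Perm A))) := by
  rw [Subgroup.disjoint_def]
  rintro _ ⟨e, rfl⟩ he
  ext x
  have hcomm := Subgroup.mem_centralizer_iff.1 he _ ⟨.ofAdd x, rfl⟩
  simpa using (DFunLike.congr_fun hcomm 0).symm

theorem toSubgroup_lowerCentralSeries_le (H : AddSubgroup A) (n : ℕ) :
    (H.lowerCentralSeries n).toSubgroup ≤ H.toSubgroup.lowerCentralSeries n := by
  induction n with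
  | zero => exact le_rfl
  | succ n ih =>
    suffices H.lowerCentralSeries (n + 1) ≤
        Subgroup.toAddSubgroup' (H.toSubgroup.lowerCentralSeries (n + 1)) from fun x hx => this hx
    refine AddSubgroup.addCommutator_le.2 fun x hx y hy => ?_
    exact Subgroup.commutator_mem_commutator (g₁ := .ofAdd x) (g₂ := .ofAdd y) (ih hx)
      (show Multiplicative.ofAdd y ∈ H.toSubgroup from hy)

theorem isNilpotent_of_isNilpotent_toSubgroup {H : AddSubgroup A}
    (hH : Group.IsNilpotent (AddSubgroup.toSubgroup H)) : AddGroup.IsNilpotent H := by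
  obtain ⟨n, hn⟩ := (Subgroup.isNilpotent_iff_lowerCentralSeries _).1 hH
  exact (AddSubgroup.isNilpotent_iff_lowerCentralSeries _).2 ⟨n, AddSubgroup.toSubgroup.injective
    (le_bot_iff.1 ((toSubgroup_lowerCentralSeries_le H n).trans hn.le))⟩

theorem isLocallyNilpotentAddGroup_of_multiplicative
    (hA : IsLocallyNilpotentGroup (Multiplicative A)) : IsLocallyNilpotentAddGroup A :=
  fun H hH => isNilpotent_of_isNilpotent_toSubgroup (hA _ (H.fg_iff_mul_fg.1 hH))

end AdditiveGroup

namespace SkewLeftBrace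

variable (A : Type*) [SkewLeftBrace A]

/-- The homomorphism `λ` with values in the permutations of `A`, where it can be compared with the
translations of `(A, +)`. -/
def lamPerm : A →* Equiv.Perm A := (addAutHom A).comp (lam A)

theorem ker_lamPerm : (lamPerm A).ker = (lam A).ker :=
  MonoidHom.ker_comp_of_injective (lam A) (addAutHom A) addAutHom_injective

variable {A} in
open scoped commutatorElement in
theorem commutatorElement_lamPerm_translationHom (a x : A) :
    ⁅lamPerm A a, translationHom A (.ofAdd x)⁆ = translationHom A (.ofAdd (star a x)) :=
  commutatorElement_addAutHom_translationHom (lam A a) x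

theorem disjoint_range_lamPerm_centralizer :
    Disjoint (lamPerm A).range
      (Subgroup.centralizer ((translationHom A).range : Set (Equiv.Perm A))) :=
  disjoint_range_addAutHom_centralizer.mono_left
    ((MonoidHom.range_comp (addAutHom A) (lam A)).trans_le (Subgroup.map_le_range _ _))

theorem map_starSpan_univ (X : AddSubgroup A) :
    (starSpan Set.univ (X : Set A)).toSubgroup.map (translationHom A) =
      ⁅(lamPerm A).range, X.toSubgroup.map (translationHom A)⁆ := by
  apply le_antisymm
  · suffices starSpan Set.univ (X : Set A) ≤ Subgroup.toAddSubgroup' (Subgroup.comap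
        (translationHom A) ⁅(lamPerm A).range, X.toSubgroup.map (translationHom A)⁆) from
      Subgroup.map_le_iff_le_comap.2 fun x hx => this hx
    refine (AddSubgroup.closure_le _).2 ?_
    rintro _ ⟨a, -, x, hx, rfl⟩
    change translationHom A (.ofAdd (star a x)) ∈
      ⁅(lamPerm A).range, X.toSubgroup.map (translationHom A)⁆
    rw [← commutatorElement_lamPerm_translationHom]
    exact Subgroup.commutator_mem_commutator ⟨a, rfl⟩ ⟨_, hx, rfl⟩
  · rw [Subgroup.commutator_le]
    rintro _ ⟨a, rfl⟩ _ ⟨x, hx, rfl⟩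
    have hstar : star a x.toAdd ∈ starSpan Set.univ (X : Set A) :=
      AddSubgroup.subset_closure ⟨a, Set.mem_univ a, x.toAdd, hx, rfl⟩
    exact ⟨.ofAdd (star a x.toAdd), hstar,
      (commutatorElement_lamPerm_translationHom a x.toAdd).symm⟩

theorem iteratedCommutator_range_lamPerm_range_translationHom (n : ℕ) :
    iteratedCommutator (lamPerm A).range (translationHom A).range n =
      (leftSeries A n).toSubgroup.map (translationHom A) := by
  induction n with
  | zero => exact MonoidHom.range_eq_map _
  | succ n ih => rw [iteratedCommutator_succ', ih, leftSeries, map_starSpan_univ]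

variable {A}

theorem IsLeftNilpotent.exists_iteratedCommutator_eq_bot (hA : IsLeftNilpotent A) :
    ∃ n, iteratedCommutator (lamPerm A).range (translationHom A).range n = ⊥ := by
  obtain ⟨n, hn⟩ := hA
  refine ⟨n, ?_⟩
  rw [iteratedCommutator_range_lamPerm_range_translationHom, hn]
  exact Subgroup.map_bot _

theorem IsLeftNilpotent.isNilpotent_range_lamPerm (hA : IsLeftNilpotent A) :
    Group.IsNilpotent (lamPerm A).range := by
  obtain ⟨n, hn⟩ := hA.exists_iteratedCommutator_eq_bot
  obtain ⟨c, hc⟩ := exists_lowerCentralSeries_le_centralizer hn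
  exact (Subgroup.isNilpotent_iff_lowerCentralSeries _).2 ⟨c, le_bot_iff.1
    (disjoint_range_lamPerm_centralizer A (Subgroup.lowerCentralSeries_le_self _ c) hc)⟩

theorem IsLeftNilpotent.isNilpotent_quotient_ker_lam (hA : IsLeftNilpotent A) :
    Group.IsNilpotent (A ⧸ (lam A).ker) :=
  (Group.isNilpotent_congr ((QuotientGroup.quotientMulEquivOfEq (ker_lamPerm A).symm).trans
    (QuotientGroup.quotientKerEquivRange (lamPerm A)))).2 hA.isNilpotent_range_lamPerm

theorem IsLeftNilpotent.isLocallyNilpotentAddGroup_leftSeries_one (hA : IsLeftNilpotent A) :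
    IsLocallyNilpotentAddGroup (leftSeries A 1) := by
  obtain ⟨n, hn⟩ := hA.exists_iteratedCommutator_eq_bot
  have := hA.isNilpotent_range_lamPerm
  have hsup := isLocallyNilpotentGroup_sup_commutator hn isLocallyNilpotentGroup_of_isNilpotent
  have hmap : IsLocallyNilpotentGroup ((leftSeries A 1).toSubgroup.map (translationHom A)) := by
    rw [← iteratedCommutator_range_lamPerm_range_translationHom]
    exact hsup.mono le_sup_right
  exact isLocallyNilpotentAddGroup_of_multiplicative (hmap.of_injective
    (f := ((leftSeries A 1).toSubgroup.equivMapOfInjective _ translationHom_injective).toMonoidHom)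
    (MulEquiv.injective _))

end SkewLeftBrace

theorem mainTheorem9_general (A : Type*) [SkewLeftBrace A]
    (hA : SkewLeftBrace.IsLeftNilpotent A) :
    IsLocallyNilpotentAddGroup (SkewLeftBrace.leftSeries A 1) ∧
      Group.IsNilpotent (A ⧸ (SkewLeftBrace.lam A).ker) :=
  ⟨hA.isLocallyNilpotentAddGroup_leftSeries_one, hA.isNilpotent_quotient_ker_lam⟩

/-- For a left nilpotent skew left brace `A`, the additive group of `A^2` (which is
`leftSeries A 1`) is locally nilpotent, and so is the quotient of the multiplicative group of `A`
by the kernel of `λ`. -/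
theorem mainTheorem9 (A : Type*) [SkewLeftBrace A] (hA : SkewLeftBrace.IsLeftNilpotent A) :
    IsLocallyNilpotentAddGroup (SkewLeftBrace.leftSeries A 1) ∧
      IsLocallyNilpotentGroup (A ⧸ (SkewLeftBrace.lam A).ker) := by
  have ⟨hadd, _⟩ := mainTheorem9_general A hA
  exact ⟨hadd, isLocallyNilpotentGroup_of_isNilpotent⟩
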